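/- Let $K$ be a perfect field, let $k\ge 1$ be an integer that is nonzero in $K$, and let $S\in K[x]$ be a polynomial with simple roots whose degree is coprime to $k$ (for example $K=\mathbb{Q}(\xi)$ with $\xi$ a primitive $k$th root of unity, $k\ge 2$). Let $L$ be an algebraically closed field containing $K$ (for example $L=\mathbb{C}$), and let $\mathcal{C}=\{(x,y)\in L^2 : y^k=S(x)\}$. A divisor on $\mathcal{C}$ is a function $D:\mathcal{C}\to\mathbb{Z}$ with finite support. It is defined over $K$ if $D(\sigma(x),\sigma(y))=D(x,y)$ for every $(x,y)\in\mathcal{C}$ and every automorphism $\sigma$ of $L$ over $K$. It is principal if there is a nonzero rational function $\varphi$ on $\mathcal{C}$, with coefficients in $L$, such that $\operatorname{ord}_z\varphi=D(z)$ for all $z\in\mathcal{C}$ (no condition is imposed at infinity). Let $D$ be a divisor on $\mathcal{C}$ that is defined over $K$ and has non-negative values. Then $D$ is principal if and only if there exists a polynomial $f\in K[x,y]$ of degree less than $k$ in $y$ such that $$\operatorname{ord}_{(x,y)} f=D(x,y)\quad\text{for all }(x,y)\in\mathcal{C},\qquad\text{and}\qquad \operatorname{wdeg} f=\sum_{z\in\mathcal{C}}D(z),$$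 where $\operatorname{ord}_{(x,y)}f$ is the order of vanishing at $(x,y)$ of the restriction of $f$ to $\mathcal{C}$, and $\operatorname{wdeg} f$ is the maximum of $ki+(\deg S)j$ over the monomials $x^iy^j$ that occur in $f$. -/

import Mathlib

open Polynomial

noncomputable section

namespace Superelliptic

variable {K : Type*} [Field K]

/-- The points with coordinates in `L` of the affine curve `y ^ k = S(x)`. -/
def Point (S : K[X]) (k : ℕ) (L : Type*) [Field L] [Algebra K L] : Type _ :=
  {p : L × L // p.2 ^ k = aeval p.1 S}

/-- The polynomial `y ^ k - S(x)` over `L`. Bivariate polynomials in `x, y` are written as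
polynomials in `y` (outer variable) with coefficients that are polynomials in `x`. -/
def equation (S : K[X]) (k : ℕ) (L : Type*) [Field L] [Algebra K L] : L[X][X] :=
  X ^ k - C (S.map (algebraMap K L))

/-- The coordinate ring `L[x, y] / (y ^ k - S(x))`. -/
abbrev CoordRing (S : K[X]) (k : ℕ) (L : Type*) [Field L] [Algebra K L] : Type _ :=
  AdjoinRoot (equation S k L)

/-- The ring of rational functions on the curve: fractions of regular functions. -/
abbrev RationalFunction (S : K[X]) (k : ℕ) (L : Type*) [Field L] [Algebra K L] : Type _ :=
  FractionRing (CoordRing S k L)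

section

variable {S : K[X]} {k : ℕ} {L : Type*} [Field L] [Algebra K L]

/-- Evaluation of regular functions at a point of the curve. -/
def evalAt (z : Point S k L) : CoordRing S k L →+* L :=
  AdjoinRoot.lift (evalRingHom z.1.1) z.1.2 (by
    have h := z.2
    simp [equation, h, eval_map_algebraMap])

/-- The ideal of the regular functions that vanish at the point `z`. -/
def idealAt (z : Point S k L) : Ideal (CoordRing S k L) := RingHom.ker (evalAt z)

instance (z : Point S k L) : (idealAt z).IsPrime := RingHom.ker_isPrime (evalAt z)

/-- The local ring of the curve at the point `z`. -/
abbrev LocalRing (z : Point S k L) : Type _ := Localization.AtPrime (idealAt z)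

/-- The order of vanishing at `z` of a regular function. -/
def ordAt (z : Point S k L) (g : CoordRing S k L) : ℕ∞ :=
  Ring.ord (LocalRing z) (algebraMap (CoordRing S k L) (LocalRing z) g)

/-- The order at `z` of a rational function `φ`, written as a fraction `g / h` of regular
functions: the order of `g` minus the order of `h`. -/
def ratOrdAt (z : Point S k L) (φ : RationalFunction S k L) : ℤ :=
  ((ordAt z (IsLocalization.sec (nonZeroDivisors (CoordRing S k L)) φ).1).toNat : ℤ) -
    ((ordAt z (IsLocalization.sec (nonZeroDivisors (CoordRing S k L)) φ).2.1).toNat : ℤ)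

/-- The action of the automorphisms of `L` over `K` on the points of the curve. -/
def conj (σ : L ≃ₐ[K] L) (z : Point S k L) : Point S k L :=
  ⟨(σ z.1.1, σ z.1.2), by
    have h := z.2
    simp only [← map_pow, h]
    exact (aeval_algHom_apply σ.toAlgHom z.1.1 S).symm⟩

end

/-- A divisor on the affine curve: an integer-valued function on its points with finite
support. -/
abbrev Divisor (S : K[X]) (k : ℕ) (L : Type*) [Field L] [Algebra K L] : Type _ :=
  Point S k L →₀ ℤ

section

variable {S : K[X]} {k : ℕ} {L : Type*} [Field L] [Algebra K L]

/-- The divisor is defined over `K`: conjugate points have the same multiplicity. -/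
def Divisor.IsDefinedOverBase (D : Divisor S k L) : Prop :=
  ∀ (σ : L ≃ₐ[K] L) (z : Point S k L), D (conj σ z) = D z

/-- The divisor is the divisor (on the affine curve) of a nonzero rational function with
coefficients in `L`. -/
def Divisor.IsPrincipal (D : Divisor S k L) : Prop :=
  ∃ φ : RationalFunction S k L, φ ≠ 0 ∧ ∀ z : Point S k L, D z = ratOrdAt z φ

/-- The sum of the values of the divisor. -/
def Divisor.deg (D : Divisor S k L) : ℤ := D.sum fun _ n => n

end

/-- The regular function on the curve given by a polynomial in `x, y` over `K`. -/
def toRegular (S : K[X]) (k : ℕ) (L : Type*) [Field L] [Algebra K L] (f : K[X][X]) :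
    CoordRing S k L :=
  AdjoinRoot.mk (equation S k L) (f.map (mapRingHom (algebraMap K L)))

/-- The weighted degree: the maximum of `k * i + (deg S) * j` over the monomials `x ^ i * y ^ j`
of `f`. -/
def wdeg (S : K[X]) (k : ℕ) (f : K[X][X]) : ℕ :=
  f.support.sup fun j => (f.coeff j).support.sup fun i => k * i + S.natDegree * j

end Superelliptic

end

/-! Since S has simple roots and k is invertible, the affine curve is smooth. Its coordinate ring A
is therefore a Dedekind domain whose nonzero primes are the ideals of the points
(`isDedekindDomain_coordRing`, `exists_idealAt_eq`). Effective divisors are thus the nonzero ideals,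
and an effective divisor of a fraction g / h is the divisor of a regular function q: div h ≤ div g
means that h divides g.

The degree is read off from the basis 1, y, …, y^(k-1) of A over L[x]. Give x weight k and y weight
deg S, so that y^k and S(x) both have weight k deg S. By coprimality the nonzero summands c_j y^j of
f have distinct weights. One permutation then dominates the determinant of multiplication by f, and
the norm of f to L[x] has degree wdeg f (`natDegree_norm`). So nonzero elements have nonzero norm,
and A is a domain. The degree of the norm is also dim A/(f), which, counted point by point, is the
degree of the divisor of f (`card_eq_wdeg`). Units have weight 0, hence are constants.

For the descent to K, an automorphism σ of L over K fixes D, so it multiplies q by a unit, that is,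
by a constant. Once a coefficient of q is normalised to 1, this constant is 1. All coefficients are
then fixed by every σ, and lie in K because K is perfect (`exists_toRegular_span_eq`). -/

noncomputable section

/-! ### Automorphisms of algebraically closed fields -/

/-- A ring automorphism of a field extends to every algebraically closed extension. -/
theorem IsAlgClosed.exists_ringEquiv_extending {E L : Type*} [Field E] [Field L] [IsAlgClosed L]
    [Algebra E L] (τ : E ≃+* E) :
    ∃ ρ : L ≃+* L, ∀ e : E, ρ (algebraMap E L e) = algebraMap E L (τ e) := by
  obtain ⟨ι, v, hv⟩ := exists_isTranscendenceBasis' E L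
  let := IsAlgClosed.isAlgClosure_of_transcendence_basis v hv
  -- L is an algebraic closure of a polynomial ring over E; τ acts on its coefficients, and
  -- uniqueness of algebraic closures extends this to L.
  let e : Algebra.adjoin E (Set.range v) ≃+* Algebra.adjoin E (Set.range v) :=
    (hv.1.aevalEquiv.symm.toRingEquiv.trans (MvPolynomial.mapEquiv ι τ)).trans
      hv.1.aevalEquiv.toRingEquiv
  refine ⟨IsAlgClosure.equivOfEquiv L L e, fun a => ?_⟩
  have h : e (algebraMap E _ a) = algebraMap E _ (τ a) := by
    change hv.1.aevalEquiv (MvPolynomial.map _ (hv.1.aevalEquiv.symm (algebraMap E _ a))) = _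
    rw [AlgEquiv.commutes, MvPolynomial.algebraMap_eq, MvPolynomial.map_C,
      ← MvPolynomial.algebraMap_eq, AlgEquiv.commutes]
    rfl
  rw [IsScalarTower.algebraMap_apply E (Algebra.adjoin E (Set.range v)) L,
    IsAlgClosure.equivOfEquiv_algebraMap, h,
    ← IsScalarTower.algebraMap_apply E (Algebra.adjoin E (Set.range v)) L]

/-- The elements of an algebraically closed field `L` that are fixed by all automorphisms over a
perfect subfield `K` lie in `K`. -/
theorem IsAlgClosed.mem_range_algebraMap_of_fixed {K L : Type*} [Field K] [PerfectField K]
    [Field L] [IsAlgClosed L] [Algebra K L] (a : L) (ha : ∀ σ : L ≃ₐ[K] L, σ a = a) :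
    a ∈ Set.range (algebraMap K L) := by
  by_cases halg : IsAlgebraic K a
  -- The relative algebraic closure is Galois over the perfect field K, and its automorphisms extend
  -- to L.
  · let E := algebraicClosure K L
    have : IsGalois K E := {
      to_normal := IsAlgClosure.normal K E }
    have hmem : (⟨a, halg.isIntegral⟩ : E) ∈ (⊥ : IntermediateField K E) := by
      rw [InfiniteGalois.mem_bot_iff_fixed]
      intro τ
      obtain ⟨ρ, hρ⟩ := IsAlgClosed.exists_ringEquiv_extending (L := L) τ.toRingEquiv
      have h := ha (AlgEquiv.ofRingEquiv (f := ρ) fun x => by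
        rw [IsScalarTower.algebraMap_apply K E L, hρ]
        exact congrArg (algebraMap E L) (τ.commutes x))
      exact Subtype.ext ((hρ ⟨a, halg.isIntegral⟩).symm.trans h)
    obtain ⟨x, hx⟩ := IntermediateField.mem_bot.1 hmem
    exact ⟨x, congrArg Subtype.val hx⟩
  -- For a transcendental, the substitution a ↦ a + 1 of K(a) extends to L and moves a.
  · exfalso
    have hinj : Function.Injective (aeval a : K[X] →ₐ[K] L) :=
      transcendental_iff_injective.1 halg
    let : Algebra (FractionRing K[X]) L :=
      (IsFractionRing.lift (g := (aeval a : K[X] →ₐ[K] L).toRingHom) hinj).toAlgebra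
    have hE : ∀ p : K[X], algebraMap (FractionRing K[X]) L (algebraMap K[X] _ p) = aeval a p :=
      fun p => IsFractionRing.lift_algebraMap (g := (aeval a : K[X] →ₐ[K] L).toRingHom) hinj p
    obtain ⟨ρ, hρ⟩ := IsAlgClosed.exists_ringEquiv_extending (L := L)
      (IsFractionRing.ringEquivOfRingEquiv (K := FractionRing K[X]) (L := FractionRing K[X])
        (algEquivAevalXAddC (1 : K)).toRingEquiv)
    have hρ' : ∀ p : K[X], ρ (aeval a p) = aeval a (p.comp (X + 1)) := fun p => by
      rw [← hE, hρ, IsFractionRing.ringEquivOfRingEquiv_algebraMap, hE]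
      simp [aeval_def, comp]
    have h := ha (AlgEquiv.ofRingEquiv (f := ρ) fun x => by simpa using hρ' (C x))
    have h1 : ρ a = a + 1 := by simpa using hρ' X
    have h2 : ρ a = a := h
    simp [h1] at h2

/-! ### Determinants with a dominant permutation -/

/-- The degree of a determinant in which, for suitable weights on rows and columns, one permutation
gives a product of strictly larger degree than all others. -/
theorem Matrix.natDegree_det_of_weights {ι F : Type*} [Fintype ι] [DecidableEq ι] [Field F]
    (M : Matrix ι ι F[X]) (r : ι → ℕ) (k w : ℕ) (τ : Equiv.Perm ι)
    (hne : ∀ j, M (τ j) j ≠ 0) (heq : ∀ j, k * (M (τ j) j).natDegree + r (τ j) = w + r j)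
    (hlt : ∀ i j, i ≠ τ j → M i j ≠ 0 → k * (M i j).natDegree + r i < w + r j) :
    M.det ≠ 0 ∧ k * M.det.natDegree = Fintype.card ι * w := by
  have hsum : ∀ σ : Equiv.Perm ι, ∑ j, (w + r j) = Fintype.card ι * w + ∑ j, r (σ j) := fun σ => by
    rw [Finset.sum_add_distrib, Equiv.sum_comp σ r]; simp
  have hprod : ∀ σ : Equiv.Perm ι, ∏ j, M (σ j) j ≠ 0 →
      k * (∏ j, M (σ j) j).natDegree + ∑ j, r (σ j) =
        ∑ j, (k * (M (σ j) j).natDegree + r (σ j)) := fun σ h => by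
    rw [natDegree_prod _ _ fun j _ => Finset.prod_ne_zero_iff.1 h j (Finset.mem_univ j),
      Finset.mul_sum, Finset.sum_add_distrib]
  set n := (∏ j, M (τ j) j).natDegree with hn
  have hτ : ∏ j, M (τ j) j ≠ 0 := Finset.prod_ne_zero_iff.2 fun j _ => hne j
  have hkn : k * n = Fintype.card ι * w := by
    have h := hprod τ hτ
    rw [Finset.sum_congr rfl fun j _ => heq j, hsum τ, ← hn] at h
    omega
  have hother : ∀ σ : Equiv.Perm ι, σ ≠ τ → (∏ j, M (σ j) j).degree < n := fun σ hσ => by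
    by_cases h0 : ∏ j, M (σ j) j = 0
    · rw [h0, degree_zero]; exact WithBot.bot_lt_coe _
    rw [← natDegree_lt_iff_degree_lt h0]
    have hM : ∀ j, M (σ j) j ≠ 0 := fun j => Finset.prod_ne_zero_iff.1 h0 j (Finset.mem_univ j)
    obtain ⟨j₀, hj₀⟩ : ∃ j, σ j ≠ τ j := by
      by_contra! h
      exact hσ (Equiv.ext h)
    have h : ∑ j, (k * (M (σ j) j).natDegree + r (σ j)) < ∑ j, (w + r j) := by
      refine Finset.sum_lt_sum (fun j _ => ?_) ⟨j₀, Finset.mem_univ _, hlt _ _ hj₀ (hM j₀)⟩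
      by_cases hj : σ j = τ j
      · rw [hj, heq]
      · exact (hlt _ _ hj (hM j)).le
    rw [← hprod σ h0, hsum σ, ← hkn] at h
    exact Nat.lt_of_mul_lt_mul_left (a := k) (by omega)
  have hdeg : M.det.degree = n := by
    rw [Matrix.det_apply, ← Finset.add_sum_erase _ _ (Finset.mem_univ τ)]
    have hs : ∀ (σ : Equiv.Perm ι) (p : F[X]),
        (Equiv.Perm.sign σ • p).degree = p.degree := fun σ p => by
      rcases Int.units_eq_one_or (Equiv.Perm.sign σ) with h | h <;> simp [h]
    rw [degree_add_eq_left_of_degree_lt, hs, degree_eq_natDegree hτ]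
    rw [hs, degree_eq_natDegree hτ, ← hn]
    refine (degree_sum_le _ _).trans_lt ((Finset.sup_lt_iff (WithBot.bot_lt_coe _)).2 ?_)
    intro σ hσ
    rw [hs]
    exact hother σ (Finset.ne_of_mem_erase hσ)
  refine ⟨fun h => by simp [h] at hdeg, ?_⟩
  rw [natDegree_eq_of_degree_eq_some hdeg, hkn]

/-! ### The norm to `L[X]` and the weighted degree -/

namespace Superelliptic
variable {K L : Type*} [Field K] [Field L] [Algebra K L] {S : K[X]} {k : ℕ}

theorem equation_monic (hk : k ≠ 0) : (equation S k L).Monic :=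
  monic_X_pow_sub_C _ hk

theorem natDegree_equation : (equation S k L).natDegree = k :=
  natDegree_X_pow_sub_C

theorem root_pow : (AdjoinRoot.root (equation S k L)) ^ k =
    algebraMap L[X] (CoordRing S k L) (S.map (algebraMap K L)) := by
  have h := AdjoinRoot.eval₂_root (equation S k L)
  rw [equation, eval₂_sub, eval₂_X_pow, eval₂_C, sub_eq_zero] at h
  exact h

/-- The coordinate ring has the basis `1, y, …, y ^ (k - 1)` over the polynomials in `x`. -/
def basisY (S : K[X]) (L : Type*) [Field L] [Algebra K L] (hk : k ≠ 0) :
    Module.Basis (Fin k) L[X] (CoordRing S k L) :=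
  (AdjoinRoot.powerBasis' (equation_monic (S := S) (L := L) hk)).basis.reindex
    (finCongr natDegree_equation)

theorem basisY_apply (hk : k ≠ 0) (i : Fin k) :
    basisY S L hk i = (AdjoinRoot.root (equation S k L)) ^ (i : ℕ) := by
  rw [basisY, Module.Basis.reindex_apply, PowerBasis.basis_eq_pow]
  rfl

/-- The matrix of the multiplication by `∑ c j * y ^ j`. -/
theorem leftMulMatrix_basisY (hk : k ≠ 0) (c : Fin k → L[X]) (i j : Fin k) :
    haveI : NeZero k := ⟨hk⟩
    Algebra.leftMulMatrix (basisY S L hk) (∑ m, c m • basisY S L hk m) i j =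
      c (i - j) * if i < j then S.map (algebraMap K L) else 1 := by
  have : NeZero k := ⟨hk⟩
  set b := basisY S L hk with hb
  have hmul : ∀ m : Fin k, b m * b j =
      (if m + j < j then S.map (algebraMap K L) else 1) • b (m + j) := fun m => by
    rw [hb, basisY_apply, basisY_apply, basisY_apply, ← pow_add, Algebra.smul_def]
    have hm := m.2
    have hj := j.2
    by_cases h : (m : ℕ) + j < k
    · have h1 : ((m + j : Fin k) : ℕ) = m + j := by rw [Fin.val_add, Nat.mod_eq_of_lt h]
      rw [if_neg (by rw [Fin.lt_def]; omega), h1, map_one, one_mul]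
    · have h1 : ((m + j : Fin k) : ℕ) + k = m + j := by
        rw [Fin.val_add, Nat.mod_eq_sub_mod (by omega), Nat.mod_eq_of_lt (by omega)]; omega
      rw [if_pos (by rw [Fin.lt_def]; omega), ← root_pow, ← pow_add, add_comm k, h1]
  rw [Algebra.leftMulMatrix_eq_repr_mul, Finset.sum_mul]
  have : ∑ m, (c m • b m) * b j =
      ∑ i, (c (i - j) * if i < j then S.map (algebraMap K L) else 1) • b i := by
    refine Eq.trans ?_ (Equiv.sum_comp (Equiv.addRight j) _)
    refine Finset.sum_congr rfl fun m _ => ?_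
    rw [smul_mul_assoc, hmul, smul_smul]
    simp only [Equiv.coe_addRight, add_sub_cancel_right]
    rfl
  rw [this, Module.Basis.repr_sum_self]

/-- The degree of the norm of `∑ c j * y ^ j` when one summand has the largest weight. -/
theorem natDegree_norm_sum (hk : k ≠ 0) (hS : S ≠ 0) (c : Fin k → L[X]) (j₀ : Fin k) (w : ℕ)
    (h0 : c j₀ ≠ 0) (hw : k * (c j₀).natDegree + S.natDegree * j₀ = w)
    (hlt : ∀ j, j ≠ j₀ → c j ≠ 0 → k * (c j).natDegree + S.natDegree * j < w) :
    Algebra.norm L[X] (∑ m, c m • basisY S L hk m) ≠ 0 ∧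
      (Algebra.norm L[X] (∑ m, c m • basisY S L hk m)).natDegree = w := by
  have : NeZero k := ⟨hk⟩
  rw [Algebra.norm_eq_matrix_det (basisY S L hk)]
  have hT : S.map (algebraMap K L) ≠ 0 :=
    (Polynomial.map_ne_zero_iff (algebraMap K L).injective).2 hS
  have hTd : (S.map (algebraMap K L)).natDegree = S.natDegree := natDegree_map _
  -- Replacing y^k by S preserves the weight, so the entry (i, j) together with y^i weighs as much
  -- as c (i - j) y^(i - j) times y^j, with or without wrap-around.
  have hM : ∀ i j : Fin k, c (i - j) ≠ 0 →
      (c (i - j) * if i < j then S.map (algebraMap K L) else 1) ≠ 0 ∧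
      k * (c (i - j) * if i < j then S.map (algebraMap K L) else 1).natDegree +
        S.natDegree * i =
      k * (c (i - j)).natDegree + S.natDegree * (i - j : Fin k) + S.natDegree * j := by
    intro i j h
    have hi := i.2
    have hj := j.2
    split_ifs with hij
    · refine ⟨mul_ne_zero h hT, ?_⟩
      rw [natDegree_mul h hT, hTd, Fin.coe_sub_iff_lt.2 hij]
      obtain ⟨e, he⟩ : ∃ e, k + (i : ℕ) - j = e ∧ k + (i : ℕ) = e + j := ⟨_, rfl, by omega⟩
      rw [he.1, mul_add, mul_comm k S.natDegree, add_assoc, ← mul_add, he.2]; ring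
    · rw [mul_one]
      refine ⟨h, ?_⟩
      have hle : j ≤ i := not_lt.1 hij
      rw [Fin.coe_sub_iff_le.2 hle, add_assoc, ← mul_add, Nat.sub_add_cancel hle]
  -- The dominant permutation j ↦ j₀ + j selects the entries that come from the heaviest summand c
  -- j₀ * y ^ j₀.
  have key := Matrix.natDegree_det_of_weights
    (Algebra.leftMulMatrix (basisY S L hk) (∑ m, c m • basisY S L hk m))
    (fun i => S.natDegree * i) k w (Equiv.addLeft j₀)
    (fun j => by
      rw [leftMulMatrix_basisY]
      exact (hM _ _ (by simpa using h0)).1)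
    (fun j => by
      rw [leftMulMatrix_basisY, (hM _ _ (by simpa using h0)).2]
      simp [hw])
    (fun i j hij h => by
      rw [leftMulMatrix_basisY] at h ⊢
      have hc := left_ne_zero_of_mul h
      rw [(hM _ _ hc).2]
      have := hlt (i - j) (fun e => hij (by simp [← e])) hc
      omega)
  refine ⟨key.1, ?_⟩
  have := key.2
  rw [Fintype.card_fin] at this
  exact Nat.eq_of_mul_eq_mul_left (Nat.pos_of_ne_zero hk) this

/-- The weighted degree of a polynomial of degree less than `k` in `y` comes from a single power
of `y`. -/
theorem exists_wdeg_eq {F : Type*} [Field F] {S : F[X]} {k : ℕ}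
    (hkS : Nat.Coprime k S.natDegree) {f : F[X][X]} (hf : f ≠ 0) (hfk : f.degree < k) :
    ∃ j₀ : Fin k, f.coeff j₀ ≠ 0 ∧
      k * (f.coeff j₀).natDegree + S.natDegree * j₀ = wdeg S k f ∧
      ∀ j : Fin k, j ≠ j₀ → f.coeff j ≠ 0 →
        k * (f.coeff j).natDegree + S.natDegree * j < wdeg S k f := by
  have hinner : ∀ j, f.coeff j ≠ 0 →
      ((f.coeff j).support.sup fun i => k * i + S.natDegree * j) =
        k * (f.coeff j).natDegree + S.natDegree * j := fun j hj =>
    le_antisymm (Finset.sup_le fun i hi => by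
        have := le_natDegree_of_mem_supp i hi
        gcongr)
      (Finset.le_sup (f := fun i => k * i + S.natDegree * j) (natDegree_mem_support_of_nonzero hj))
  have hlt : ∀ j ∈ f.support, j < k := fun j hj =>
    WithBot.coe_lt_coe.1 ((le_degree_of_mem_supp j hj).trans_lt hfk)
  obtain ⟨j₀, hj₀, hsup⟩ := Finset.exists_mem_eq_sup f.support (support_nonempty.2 hf)
    fun j => (f.coeff j).support.sup fun i => k * i + S.natDegree * j
  change wdeg S k f = _ at hsup
  rw [hinner _ (mem_support_iff.1 hj₀)] at hsup
  refine ⟨⟨j₀, hlt _ hj₀⟩, mem_support_iff.1 hj₀, hsup.symm, fun j hj hcj => ?_⟩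
  have hle : k * (f.coeff j).natDegree + S.natDegree * j ≤ wdeg S k f := by
    rw [← hinner j hcj]
    exact Finset.le_sup (f := fun j => (f.coeff j).support.sup fun i => k * i + S.natDegree * j)
      (mem_support_iff.2 hcj)
  refine lt_of_le_of_ne hle fun h => hj (Fin.ext ?_)
  rw [hsup] at h
  -- Modulo k the weight is deg S * j, which determines j < k by coprimality; so there are no ties.
  have hmod : S.natDegree * (j : ℕ) ≡ S.natDegree * j₀ [MOD k] := by
    have := congrArg (· % k) h
    simpa [Nat.ModEq, Nat.mul_add_mod] using this
  exact Nat.ModEq.eq_of_lt_of_lt (hmod.cancel_left_of_coprime hkS) j.2 (hlt _ hj₀)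

/-- The regular function given by a polynomial in `x, y`. -/
theorem mk_eq_sum (hk : k ≠ 0) {f : L[X][X]} (hfk : f.degree < k) :
    AdjoinRoot.mk (equation S k L) f = ∑ j : Fin k, f.coeff j • basisY S L hk j := by
  have hn : f.natDegree < k := by
    by_cases hf : f = 0
    · simpa [hf] using Nat.pos_of_ne_zero hk
    · exact (natDegree_lt_iff_degree_lt hf).2 hfk
  conv_lhs => rw [as_sum_range' f k hn]
  rw [map_sum, Finset.sum_range]
  refine Finset.sum_congr rfl fun j _ => ?_
  rw [basisY_apply, ← C_mul_X_pow_eq_monomial, map_mul, map_pow, AdjoinRoot.mk_X,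
    Algebra.smul_def]
  rfl

/-- Every regular function is given by a polynomial of degree less than `k` in `y`. -/
theorem exists_mk_eq (hk : k ≠ 0) (g : CoordRing S k L) :
    ∃ f : L[X][X], f.degree < k ∧ AdjoinRoot.mk (equation S k L) f = g := by
  obtain ⟨f, rfl⟩ := AdjoinRoot.mk_surjective g
  refine ⟨f %ₘ equation S k L, ?_, ?_⟩
  · have h := degree_modByMonic_lt f (equation_monic (S := S) (L := L) hk)
    rwa [degree_eq_natDegree (equation_monic (S := S) (L := L) hk).ne_zero,
      natDegree_equation] at h
  · refine (AdjoinRoot.mk_eq_mk.2 ?_)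
    exact ⟨-(f /ₘ equation S k L), by
      rw [modByMonic_eq_sub_mul_div]; ring⟩

theorem mk_injOn (hk : k ≠ 0) {f g : L[X][X]} (hf : f.degree < k) (hg : g.degree < k)
    (h : AdjoinRoot.mk (equation S k L) f = AdjoinRoot.mk (equation S k L) g) : f = g := by
  rw [mk_eq_sum hk hf, mk_eq_sum hk hg] at h
  have h' := congrArg (basisY S L hk).repr h
  ext1 j
  by_cases hj : j < k
  · have := DFunLike.congr_fun h' ⟨j, hj⟩
    rwa [Module.Basis.repr_sum_self, Module.Basis.repr_sum_self] at this
  · have hj : (k : WithBot ℕ) ≤ j := by exact_mod_cast not_lt.1 hj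
    rw [coeff_eq_zero_of_degree_lt (hf.trans_le hj), coeff_eq_zero_of_degree_lt (hg.trans_le hj)]

theorem natDegree_norm (hk : k ≠ 0) (hS : S ≠ 0) (hkS : Nat.Coprime k S.natDegree)
    {f : L[X][X]} (hf : f ≠ 0) (hfk : f.degree < k) :
    Algebra.norm L[X] (AdjoinRoot.mk (equation S k L) f) ≠ 0 ∧
      (Algebra.norm L[X] (AdjoinRoot.mk (equation S k L) f)).natDegree =
        wdeg (S.map (algebraMap K L)) k f := by
  have hd : (S.map (algebraMap K L)).natDegree = S.natDegree := natDegree_map _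
  obtain ⟨j₀, h0, hw, hlt⟩ := exists_wdeg_eq (S := S.map (algebraMap K L)) (by rwa [hd]) hf hfk
  rw [hd] at hw hlt
  rw [mk_eq_sum hk hfk]
  exact natDegree_norm_sum hk hS (fun j => f.coeff j) j₀ _ h0 hw hlt

theorem norm_ne_zero (hk : k ≠ 0) (hS : S ≠ 0) (hkS : Nat.Coprime k S.natDegree)
    {g : CoordRing S k L} (hg : g ≠ 0) : Algebra.norm L[X] g ≠ 0 := by
  obtain ⟨f, hfk, rfl⟩ := exists_mk_eq hk g
  exact (natDegree_norm hk hS hkS (fun h => hg (by rw [h, map_zero])) hfk).1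

theorem degree_equation_ne_zero (hk : k ≠ 0) : (equation S k L).degree ≠ 0 := by
  rw [degree_eq_natDegree (equation_monic hk).ne_zero, natDegree_equation]
  exact_mod_cast hk

/-- The norm is multiplicative and vanishes only at 0. -/
theorem isDomain_coordRing (hk : k ≠ 0) (hS : S ≠ 0) (hkS : Nat.Coprime k S.natDegree) :
    IsDomain (CoordRing S k L) := by
  have : Nontrivial (CoordRing S k L) := AdjoinRoot.nontrivial _ (degree_equation_ne_zero hk)
  have : NoZeroDivisors (CoordRing S k L) := ⟨fun {a b} hab => by
    have : Module.Free L[X] (CoordRing S k L) := .of_basis (basisY S L hk)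
    have : Module.Finite L[X] (CoordRing S k L) := .of_basis (basisY S L hk)
    by_contra! h
    have hn := mul_ne_zero (norm_ne_zero hk hS hkS h.1) (norm_ne_zero hk hS hkS h.2)
    rw [← map_mul, hab, Algebra.norm_zero] at hn
    exact hn rfl⟩
  exact NoZeroDivisors.to_isDomain _

/-- The cokernel of an injective endomorphism of a free `L[X]`-module of finite rank has dimension
over L equal to the degree of the determinant, here the norm. -/
theorem finrank_quotient_span (hk : k ≠ 0) (hS : S ≠ 0) (hkS : Nat.Coprime k S.natDegree)
    {f : L[X][X]} (hf : f ≠ 0) (hfk : f.degree < k) :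
    Module.finrank L (CoordRing S k L ⧸ Ideal.span {AdjoinRoot.mk (equation S k L) f}) =
      wdeg (S.map (algebraMap K L)) k f := by
  have := isDomain_coordRing (L := L) hk hS hkS
  rw [← (natDegree_norm hk hS hkS hf hfk).2]
  exact finrank_quotient_span_eq_natDegree_norm (basisY S L hk) fun h =>
    hf (mk_injOn (S := S) hk hfk (by simp) (by rw [h, map_zero]))

/-! ### Points and their maximal ideals -/

theorem evalAt_algebraMap (z : Point S k L) (p : L[X]) :
    evalAt z (algebraMap L[X] (CoordRing S k L) p) = p.eval z.1.1 :=
  AdjoinRoot.lift_of _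

theorem evalAt_root (z : Point S k L) :
    evalAt z (AdjoinRoot.root (equation S k L)) = z.1.2 :=
  AdjoinRoot.lift_root _

theorem mem_idealAt {z : Point S k L} {g : CoordRing S k L} : g ∈ idealAt z ↔ evalAt z g = 0 :=
  RingHom.mem_ker

/-- The regular function `x - a`. -/
def xSub (S : K[X]) (k : ℕ) (a : L) : CoordRing S k L :=
  algebraMap L[X] (CoordRing S k L) (X - C a)

/-- The regular function `y - b`. -/
def ySub (S : K[X]) (k : ℕ) (b : L) : CoordRing S k L :=
  AdjoinRoot.root (equation S k L) - algebraMap L[X] (CoordRing S k L) (C b)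

theorem xSub_mem_idealAt (z : Point S k L) : xSub S k z.1.1 ∈ idealAt z := by
  rw [mem_idealAt, xSub, evalAt_algebraMap]; simp

theorem ySub_mem_idealAt (z : Point S k L) : ySub S k z.1.2 ∈ idealAt z := by
  rw [mem_idealAt, ySub, map_sub, evalAt_algebraMap, evalAt_root]; simp

/-- Modulo J, x and y become the coordinates of z, so every regular function becomes its value at z.
-/
theorem idealAt_le {z : Point S k L} {J : Ideal (CoordRing S k L)} (hx : xSub S k z.1.1 ∈ J)
    (hy : ySub S k z.1.2 ∈ J) : idealAt z ≤ J := by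
  have h : Ideal.Quotient.mk J = ((Ideal.Quotient.mk J).comp
      ((algebraMap L[X] (CoordRing S k L)).comp C)).comp (evalAt z) := by
    refine AdjoinRoot.ringHom_ext (Polynomial.ringHom_ext (fun a => ?_) ?_) ?_
    · change Ideal.Quotient.mk J (algebraMap L[X] (CoordRing S k L) (C a)) =
        Ideal.Quotient.mk J (algebraMap L[X] (CoordRing S k L)
          (C (evalAt z (algebraMap L[X] (CoordRing S k L) (C a)))))
      rw [evalAt_algebraMap, eval_C]
    · change Ideal.Quotient.mk J (algebraMap L[X] (CoordRing S k L) X) =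
        Ideal.Quotient.mk J (algebraMap L[X] (CoordRing S k L)
          (C (evalAt z (algebraMap L[X] (CoordRing S k L) X))))
      rw [evalAt_algebraMap, eval_X, Ideal.Quotient.mk_eq_mk_iff_sub_mem, ← map_sub]
      exact hx
    · change Ideal.Quotient.mk J (AdjoinRoot.root (equation S k L)) =
        Ideal.Quotient.mk J (algebraMap L[X] (CoordRing S k L)
          (C (evalAt z (AdjoinRoot.root (equation S k L)))))
      rw [evalAt_root, Ideal.Quotient.mk_eq_mk_iff_sub_mem]
      exact hy
  intro g hg
  rw [← Ideal.Quotient.eq_zero_iff_mem, h, RingHom.comp_apply, mem_idealAt.1 hg, map_zero]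

theorem idealAt_eq_span (z : Point S k L) :
    idealAt z = Ideal.span {xSub S k z.1.1, ySub S k z.1.2} := by
  refine le_antisymm (idealAt_le (Ideal.subset_span (by simp)) (Ideal.subset_span (by simp))) ?_
  rw [Ideal.span_le, Set.insert_subset_iff, Set.singleton_subset_iff]
  exact ⟨xSub_mem_idealAt z, ySub_mem_idealAt z⟩

theorem evalAt_surjective (z : Point S k L) : Function.Surjective (evalAt z) := fun a =>
  ⟨algebraMap L[X] _ (C a), by rw [evalAt_algebraMap, eval_C]⟩

instance (z : Point S k L) : (idealAt z).IsMaximal :=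
  RingHom.ker_isMaximal_of_surjective _ (evalAt_surjective z)

theorem idealAt_injective : Function.Injective (idealAt : Point S k L → _) := by
  intro z w h
  have hx : xSub S k z.1.1 ∈ idealAt w := h ▸ xSub_mem_idealAt z
  have hy : ySub S k z.1.2 ∈ idealAt w := h ▸ ySub_mem_idealAt z
  rw [mem_idealAt, xSub, evalAt_algebraMap, eval_sub, eval_X, eval_C, sub_eq_zero] at hx
  rw [mem_idealAt, ySub, map_sub, evalAt_algebraMap, evalAt_root, eval_C, sub_eq_zero] at hy
  exact Subtype.ext (Prod.ext hx.symm hy.symm)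

theorem algebraMap_injective (hk : k ≠ 0) :
    Function.Injective (algebraMap L[X] (CoordRing S k L)) :=
  AdjoinRoot.of.injective_of_degree_ne_zero (degree_equation_ne_zero hk)

theorem idealAt_ne_bot (hk : k ≠ 0) (z : Point S k L) : idealAt z ≠ ⊥ := fun h => by
  have hx := xSub_mem_idealAt z
  rw [h, Ideal.mem_bot, xSub, map_eq_zero_iff _ (algebraMap_injective hk)] at hx
  exact X_sub_C_ne_zero _ hx

theorem isNoetherianRing_coordRing : IsNoetherianRing (CoordRing S k L) :=
  inferInstance

/-! ### Smoothness and the Dedekind property -/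

/-- The maximal ideal of the local ring at a point of the curve is principal. -/
theorem maximalIdeal_isPrincipal (hk : (k : K) ≠ 0) (hS : S.Separable) (z : Point S k L) :
    (IsLocalRing.maximalIdeal (LocalRing z)).IsPrincipal := by
  have hk0 : k ≠ 0 := fun h => hk (by simp [h])
  have hkL : (k : L) ≠ 0 := by
    rw [← map_natCast (algebraMap K L)]
    exact (_root_.map_ne_zero _).2 hk
  set T := S.map (algebraMap K L) with hT
  have hTz : z.1.2 ^ k = T.eval z.1.1 := by rw [hT, eval_map_algebraMap]; exact z.2
  rw [← Localization.AtPrime.map_eq_maximalIdeal]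
  suffices h : ((Ideal.span {xSub S k z.1.1, ySub S k z.1.2}).map
      (algebraMap (CoordRing S k L) (LocalRing z))).IsPrincipal by
    rwa [← idealAt_eq_span] at h
  rw [Ideal.map_span, Set.image_pair]
  set φ := algebraMap (CoordRing S k L) (LocalRing z)
  have hunit : ∀ g, evalAt z g ≠ 0 → IsUnit (φ g) := fun g hg =>
    IsLocalization.map_units (LocalRing z)
      (⟨g, fun h => hg (mem_idealAt.1 h)⟩ : (idealAt z).primeCompl)
  by_cases hb : z.1.2 = 0
  -- At a branch point y is a uniformizer: S = (x - a) s with s(a) ≠ 0 because the root is simple,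
  -- so x - a is y^k up to a unit.
  · refine ⟨φ (ySub S k z.1.2), le_antisymm ?_ (Ideal.span_mono (by simp))⟩
    rw [Ideal.submodule_span_eq, Ideal.span_le, Set.insert_subset_iff, Set.singleton_subset_iff]
    refine ⟨?_, Ideal.subset_span rfl⟩
    have hroot : T.IsRoot z.1.1 := by rw [IsRoot, ← hTz, hb, zero_pow hk0]
    obtain ⟨s, hs⟩ := dvd_iff_isRoot.2 hroot
    have hs0 : s.eval z.1.1 ≠ 0 := fun h0 => by
      have hsep : T.Separable := hS.map
      have hder : T.derivative.eval z.1.1 = 0 := by rw [hs]; simp [h0]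
      exact hsep.eval₂_derivative_ne_zero (RingHom.id L) hroot hder
    have hrel : xSub S k z.1.1 * algebraMap L[X] _ s =
        ySub S k z.1.2 * ySub S k z.1.2 ^ (k - 1) := by
      rw [mul_pow_sub_one hk0, ySub, hb, C_0, map_zero, sub_zero, root_pow, xSub, ← map_mul, ← hs]
    rw [SetLike.mem_coe, Ideal.mem_span_singleton,
      ← (hunit (algebraMap L[X] _ s) (by rwa [evalAt_algebraMap])).dvd_mul_right, ← map_mul, hrel,
      map_mul]
    exact dvd_mul_right _ _
  -- Elsewhere x - a is a uniformizer: u = (y^k - b^k) / (y - b) takes the value k b^(k-1) ≠ 0, and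
  -- u (y - b) = S(x) - S(a) is a multiple of x - a.
  · refine ⟨φ (xSub S k z.1.1), le_antisymm ?_ (Ideal.span_mono (by simp))⟩
    rw [Ideal.submodule_span_eq, Ideal.span_le, Set.insert_subset_iff, Set.singleton_subset_iff]
    refine ⟨Ideal.subset_span rfl, ?_⟩
    obtain ⟨q, hq⟩ : X - C z.1.1 ∣ T - C (T.eval z.1.1) := X_sub_C_dvd_sub_C_eval
    set u : CoordRing S k L := ∑ i ∈ Finset.range k, AdjoinRoot.root (equation S k L) ^ i *
      algebraMap L[X] _ (C z.1.2) ^ (k - 1 - i) with hu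
    have hrel : u * ySub S k z.1.2 = xSub S k z.1.1 * algebraMap L[X] _ q := by
      rw [hu, ySub, (Commute.all _ _).geom_sum₂_mul, root_pow, xSub, ← map_mul, ← hq, ← hTz]
      simp [hT]
    have hu0 : evalAt z u ≠ 0 := by
      rw [hu, map_sum, Finset.sum_congr rfl (g := fun _ => z.1.2 ^ (k - 1))]
      · simpa [hkL] using fun h : z.1.2 = 0 => absurd h hb
      · intro i hi
        rw [map_mul, map_pow, map_pow, evalAt_algebraMap, evalAt_root, eval_C, ← pow_add]
        congr 1
        have := Finset.mem_range.1 hi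
        omega
    rw [SetLike.mem_coe, Ideal.mem_span_singleton, ← (hunit u hu0).dvd_mul_left, ← map_mul, hrel,
      map_mul]
    exact dvd_mul_right _ _

theorem isDiscreteValuationRing_localRing (hk : (k : K) ≠ 0) (hS : S.Separable)
    (hkS : Nat.Coprime k S.natDegree) (z : Point S k L) :
    haveI := isDomain_coordRing (L := L) (k := k) (fun h => hk (by simp [h])) hS.ne_zero hkS
    IsDiscreteValuationRing (LocalRing z) := by
  have hk0 : k ≠ 0 := fun h => hk (by simp [h])
  have := isDomain_coordRing (L := L) hk0 hS.ne_zero hkS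
  have hfield : ¬ IsField (LocalRing z) :=
    IsLocalization.AtPrime.not_isField (CoordRing S k L) (idealAt_ne_bot hk0 z) _
  exact ((IsDiscreteValuationRing.TFAE (LocalRing z) hfield).out 0 4).2
    (maximalIdeal_isPrincipal hk hS z)

/-- The nonzero prime ideals of the coordinate ring are the ideals of the points. -/
theorem exists_idealAt_eq [IsAlgClosed L] [IsDomain (CoordRing S k L)] (hk : k ≠ 0)
    (P : Ideal (CoordRing S k L)) [P.IsPrime]
    (hP : P ≠ ⊥) : ∃ z : Point S k L, idealAt z = P := by
  have : Module.Finite L[X] (CoordRing S k L) := .of_basis (basisY S L hk)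
  -- By integrality P contains a nonzero polynomial in x. It splits over L, so P contains some x -
  -- a, then y^k - S(a), and hence some y - b.
  have hbot : P.comap (algebraMap L[X] (CoordRing S k L)) ≠ ⊥ :=
    Ideal.IsIntegral.comap_ne_bot _ hP
  obtain ⟨p, hp, hp0⟩ := Submodule.exists_mem_ne_zero_of_ne_bot hbot
  have hpP : algebraMap L[X] (CoordRing S k L) p ∈ P := hp
  obtain ⟨a, ha⟩ : ∃ a, xSub S k a ∈ P := by
    rw [(IsAlgClosed.splits p).eq_prod_roots, map_mul, map_multiset_prod, Multiset.map_map] at hpP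
    rcases Ideal.IsPrime.mem_or_mem ‹_› hpP with h | h
    · refine absurd (Ideal.eq_top_of_isUnit_mem _ h ?_) (Ideal.IsPrime.ne_top ‹_›)
      exact ((isUnit_C.2 (leadingCoeff_ne_zero.2 hp0).isUnit)).map _
    · obtain ⟨_, ha, haP⟩ := (Ideal.IsPrime.multiset_prod_mem_iff_exists_mem ‹_› _).1 h
      obtain ⟨a, -, rfl⟩ := Multiset.mem_map.1 ha
      exact ⟨a, haP⟩
  set T := S.map (algebraMap K L) with hT
  obtain ⟨b, hb, hbP⟩ : ∃ b, b ^ k = T.eval a ∧ ySub S k b ∈ P := by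
    have hsp := (IsAlgClosed.splits (X ^ k - C (T.eval a))).eq_prod_roots
    have hmon : (X ^ k - C (T.eval a)).Monic := monic_X_pow_sub_C _ hk
    rw [hmon.leadingCoeff, C_1, one_mul] at hsp
    have hmem : aeval (AdjoinRoot.root (equation S k L)) (X ^ k - C (T.eval a)) ∈ P := by
      obtain ⟨q, hq⟩ : X - C a ∣ T - C (T.eval a) := X_sub_C_dvd_sub_C_eval
      have : aeval (AdjoinRoot.root (equation S k L)) (X ^ k - C (T.eval a)) =
          xSub S k a * algebraMap L[X] _ q := by
        rw [xSub, ← map_mul, ← hq, map_sub, map_sub, map_pow, aeval_X, aeval_C, root_pow]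
        rfl
      rw [this]
      exact P.mul_mem_right _ ha
    rw [hsp, map_multiset_prod, Multiset.map_map] at hmem
    obtain ⟨_, hmap, hbP⟩ := (Ideal.IsPrime.multiset_prod_mem_iff_exists_mem ‹_› _).1 hmem
    obtain ⟨b, hb, rfl⟩ := Multiset.mem_map.1 hmap
    refine ⟨b, ?_, ?_⟩
    · have := (mem_roots hmon.ne_zero).1 hb
      simpa [sub_eq_zero] using this
    · have h : aeval (AdjoinRoot.root (equation S k L)) (X - C b) = ySub S k b := by
        rw [map_sub, aeval_X, aeval_C]; rfl
      exact h ▸ hbP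
  let z : Point S k L := ⟨(a, b), by rw [hb, hT, eval_map_algebraMap]⟩
  exact ⟨z, Ideal.IsMaximal.eq_of_le inferInstance (Ideal.IsPrime.ne_top ‹_›)
    (idealAt_le (z := z) ha hbP)⟩

theorem isDedekindDomain_coordRing [IsAlgClosed L] (hk : (k : K) ≠ 0) (hS : S.Separable)
    (hkS : Nat.Coprime k S.natDegree) : IsDedekindDomain (CoordRing S k L) := by
  have hk0 : k ≠ 0 := fun h => hk (by simp [h])
  have := isDomain_coordRing (L := L) hk0 hS.ne_zero hkS
  have : IsDedekindDomainDvr (CoordRing S k L) :=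
    { isNoetherianRing_coordRing (S := S) (k := k) (L := L) with
      is_dvr_at_nonzero_prime := fun P hP _ => by
        obtain ⟨z, rfl⟩ := exists_idealAt_eq hk0 P hP
        exact isDiscreteValuationRing_localRing hk hS hkS z }
  infer_instance

/-! ### Effective divisors as ideals, and their degree -/

/-- The ideal of the functions that vanish on the effective divisor `s`. -/
def vanishingIdeal (s : Multiset (Point S k L)) : Ideal (CoordRing S k L) :=
  (s.map idealAt).prod

theorem vanishingIdeal_zero : vanishingIdeal (0 : Multiset (Point S k L)) = ⊤ := by
  rw [vanishingIdeal, Multiset.map_zero, Multiset.prod_zero, Ideal.one_eq_top]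

theorem vanishingIdeal_cons (z : Point S k L) (s : Multiset (Point S k L)) :
    vanishingIdeal (z ::ₘ s) = idealAt z * vanishingIdeal s := by
  rw [vanishingIdeal, Multiset.map_cons, Multiset.prod_cons]; rfl

theorem vanishingIdeal_anti {s t : Multiset (Point S k L)} (h : s ≤ t) :
    vanishingIdeal t ≤ vanishingIdeal s := by
  obtain ⟨u, rfl⟩ := Multiset.le_iff_exists_add.1 h
  rw [vanishingIdeal, Multiset.map_add, Multiset.prod_add]
  exact Ideal.mul_le_left

theorem vanishingIdeal_ne_bot [IsDomain (CoordRing S k L)] (hk : k ≠ 0)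
    (s : Multiset (Point S k L)) : vanishingIdeal s ≠ ⊥ := by
  refine Multiset.prod_ne_zero fun h => ?_
  obtain ⟨z, -, hz⟩ := Multiset.mem_map.1 h
  exact idealAt_ne_bot hk z hz

theorem exists_vanishingIdeal_eq [IsAlgClosed L] [IsDedekindDomain (CoordRing S k L)]
    (hk : k ≠ 0) (I : Ideal (CoordRing S k L)) (hI : I ≠ ⊥) :
    ∃ s : Multiset (Point S k L), vanishingIdeal s = I := by
  induction I using UniqueFactorizationMonoid.induction_on_prime with
  | h₁ => exact absurd rfl hI
  | h₂ x hx => exact ⟨0, by rw [vanishingIdeal_zero, Ideal.isUnit_iff.1 hx]⟩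
  | h₃ a p ha hp ih =>
    obtain ⟨s, rfl⟩ := ih ha
    have := Ideal.isPrime_of_prime hp
    obtain ⟨z, rfl⟩ := exists_idealAt_eq hk p hp.ne_zero
    exact ⟨z ::ₘ s, vanishingIdeal_cons z s⟩

open Classical in
-- Only the factors at z survive localization: for w ≠ z some function vanishes at w but not at z,
-- and becomes a unit.
theorem map_vanishingIdeal (z : Point S k L) (s : Multiset (Point S k L)) :
    (vanishingIdeal s).map (algebraMap _ (LocalRing z)) =
      IsLocalRing.maximalIdeal (LocalRing z) ^ s.count z := by
  induction s using Multiset.induction_on with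
  | empty => simp [vanishingIdeal_zero, Ideal.map_top, Ideal.one_eq_top]
  | cons w s ih =>
    rw [vanishingIdeal_cons, Ideal.map_mul, ih]
    by_cases h : z = w
    · subst h
      rw [Localization.AtPrime.map_eq_maximalIdeal, Multiset.count_cons_self, pow_succ']
    · have hle : ¬ idealAt w ≤ idealAt z := fun hle => h (idealAt_injective
        (Ideal.IsMaximal.eq_of_le inferInstance (Ideal.IsPrime.ne_top inferInstance) hle)).symm
      obtain ⟨g, hgw, hgz⟩ := SetLike.not_le_iff_exists.1 hle
      have htop : (idealAt w).map (algebraMap _ (LocalRing z)) = ⊤ :=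
        Ideal.eq_top_of_isUnit_mem _ (Ideal.mem_map_of_mem _ hgw)
          (IsLocalization.map_units (LocalRing z) (⟨g, hgz⟩ : (idealAt z).primeCompl))
      rw [htop, Multiset.count_cons_of_ne h, Ideal.top_mul]

open Classical in
/-- The order at `z` of a regular function is the multiplicity of `z` in its divisor. -/
theorem ordAt_eq_count [IsDomain (CoordRing S k L)] (z : Point S k L)
    [IsDiscreteValuationRing (LocalRing z)] {g : CoordRing S k L} {s : Multiset (Point S k L)}
    (h : vanishingIdeal s = Ideal.span {g}) : ordAt z g = s.count z := by
  have hmap := map_vanishingIdeal z s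
  obtain ⟨ϖ, hϖ⟩ := IsDiscreteValuationRing.exists_irreducible (LocalRing z)
  rw [h, Ideal.map_span, Set.image_singleton, hϖ.maximalIdeal_eq, Ideal.span_singleton_pow,
    Ideal.span_singleton_eq_span_singleton] at hmap
  rw [ordAt, Ring.ord_eq_of_associated hmap,
    Ring.ord_pow (mem_nonZeroDivisors_of_ne_zero hϖ.ne_zero), Ring.ord_of_irreducible hϖ]
  simp

theorem ordAt_zero [IsDomain (CoordRing S k L)] (z : Point S k L)
    [IsDiscreteValuationRing (LocalRing z)] : ordAt z 0 = ⊤ := by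
  rw [ordAt, map_zero, Ring.ord_eq_addVal, AddValuation.map_zero]

theorem ordAt_mul [IsDomain (CoordRing S k L)] (z : Point S k L)
    [IsDiscreteValuationRing (LocalRing z)] (g h : CoordRing S k L) :
    ordAt z (g * h) = ordAt z g + ordAt z h := by
  rw [ordAt, map_mul, Ring.ord_eq_addVal, AddValuation.map_mul, ordAt, ordAt,
    Ring.ord_eq_addVal, Ring.ord_eq_addVal]

/-- Invertibility of I leaves no ideal strictly between `idealAt z * I` and I, so any π in the
difference spans the quotient, on which functions act through their value at z. Hence the quotient
is a line over L. -/
theorem length_quotient_idealAt_mul [IsDedekindDomain (CoordRing S k L)]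
    (z : Point S k L) (I : Ideal (CoordRing S k L)) (hI : I ≠ ⊥) :
    Module.length L (CoordRing S k L ⧸ idealAt z * I) =
      1 + Module.length L (CoordRing S k L ⧸ I) := by
  have hle : idealAt z * I ≤ I := Ideal.mul_le_right
  have hlt : ¬ I ≤ idealAt z * I := fun h => by
    have h1 : idealAt z * I = ⊤ * I := by rw [Ideal.top_mul]; exact le_antisymm hle h
    exact Ideal.IsPrime.ne_top (I := idealAt z) inferInstance (mul_right_cancel₀ hI h1)
  obtain ⟨π, hπI, hπ⟩ := SetLike.not_le_iff_exists.1 hlt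
  have hsup : Ideal.span {π} ⊔ idealAt z * I = I := by
    have hJ : Ideal.span {π} ⊔ idealAt z * I ≤ I :=
      sup_le ((Ideal.span_singleton_le_iff_mem _).2 hπI) hle
    -- Cancelling I gives `idealAt z ≤ J`. By maximality J is `idealAt z` or ⊤, and the choice of π
    -- excludes the former.
    obtain ⟨J, hJ⟩ := Ideal.dvd_iff_le.2 hJ
    have hzJ : idealAt z ≤ J := by
      have h1 : idealAt z * I ≤ J * I := by rw [mul_comm J, ← hJ]; exact le_sup_right
      exact Ideal.dvd_iff_le.1 ((mul_dvd_mul_iff_right hI).1 (Ideal.dvd_iff_le.2 h1))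
    by_cases htop : J = ⊤
    · rw [hJ, htop, Ideal.mul_top]
    · have := Ideal.IsMaximal.eq_of_le (I := idealAt z) inferInstance htop hzJ
      refine absurd ?_ hπ
      rw [this, mul_comm, ← hJ]
      exact Ideal.mem_sup_left (Ideal.mem_span_singleton_self π)
  have hC : ∀ c : L, evalAt z (algebraMap L _ c) = c := fun c => by
    rw [IsScalarTower.algebraMap_apply L L[X] (CoordRing S k L), evalAt_algebraMap]
    simp
  have key := Module.length_eq_add_of_exact
    (LinearMap.toSpanSingleton L (CoordRing S k L ⧸ idealAt z * I) (Ideal.Quotient.mk _ π))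
    (Ideal.Quotient.factorₐ L hle).toLinearMap
    (by
      rw [injective_iff_map_eq_zero]
      intro c hc
      by_contra hc0
      rw [LinearMap.toSpanSingleton_apply] at hc
      have h1 := congrArg (c⁻¹ • ·) hc
      simp only [smul_smul, inv_mul_cancel₀ hc0, one_smul, smul_zero] at h1
      exact hπ (Ideal.Quotient.eq_zero_iff_mem.1 h1))
    (Ideal.Quotient.factor_surjective hle)
    (by
      intro u
      obtain ⟨u, rfl⟩ := Ideal.Quotient.mk_surjective u
      change Ideal.Quotient.mk I u = 0 ↔ _
      rw [Ideal.Quotient.eq_zero_iff_mem]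
      constructor
      · intro hu
        rw [← hsup, Submodule.mem_sup] at hu
        obtain ⟨_, hv, w, hw, rfl⟩ := hu
        obtain ⟨a, rfl⟩ := Ideal.mem_span_singleton'.1 hv
        refine ⟨evalAt z a, ?_⟩
        rw [LinearMap.toSpanSingleton_apply, ← Ideal.Quotient.mkₐ_eq_mk L, ← map_smul,
          Ideal.Quotient.mkₐ_eq_mk, Ideal.Quotient.mk_eq_mk_iff_sub_mem, Algebra.smul_def,
          ← sub_sub, ← sub_mul]
        refine Ideal.sub_mem _ (Ideal.mul_mem_mul ?_ hπI) hw
        rw [mem_idealAt, map_sub, hC, sub_self]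
      · rintro ⟨c, hc⟩
        rw [LinearMap.toSpanSingleton_apply, ← Ideal.Quotient.mkₐ_eq_mk L, ← map_smul,
          Ideal.Quotient.mkₐ_eq_mk, Ideal.Quotient.mk_eq_mk_iff_sub_mem, Algebra.smul_def] at hc
        have := Ideal.sub_mem _ (I.mul_mem_left (algebraMap L _ c) hπI) (hle hc)
        simpa using this)
  rw [key, Module.length_eq_one]

theorem length_quotient_vanishingIdeal [IsDedekindDomain (CoordRing S k L)] (hk : k ≠ 0)
    (s : Multiset (Point S k L)) :
    Module.length L (CoordRing S k L ⧸ vanishingIdeal s) = s.card := by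
  induction s using Multiset.induction_on with
  | empty =>
    have : Subsingleton (CoordRing S k L ⧸ vanishingIdeal (0 : Multiset (Point S k L))) :=
      Ideal.Quotient.subsingleton_iff.2 vanishingIdeal_zero
    simp
  | cons z s ih =>
    rw [vanishingIdeal_cons, length_quotient_idealAt_mul z _ (vanishingIdeal_ne_bot hk s), ih,
      Multiset.card_cons, add_comm]
    push_cast
    rfl

/-- The degree of the divisor of a polynomial on the affine curve is its weighted degree. -/
theorem card_eq_wdeg [IsDedekindDomain (CoordRing S k L)] (hk : k ≠ 0) (hS : S ≠ 0)
    (hkS : Nat.Coprime k S.natDegree) {f : L[X][X]} (hf : f ≠ 0) (hfk : f.degree < k)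
    {s : Multiset (Point S k L)}
    (h : vanishingIdeal s = Ideal.span {AdjoinRoot.mk (equation S k L) f}) :
    s.card = wdeg (S.map (algebraMap K L)) k f := by
  have hlen := length_quotient_vanishingIdeal hk s
  have hfin : Module.Finite L (CoordRing S k L ⧸ vanishingIdeal s) := by
    -- Finiteness is needed to pass from length to `finrank`, which is 0 by default on
    -- infinite-dimensional spaces.
    have hfl := Module.length_ne_top_iff.1 (hlen ▸ ENat.natCast_ne_top _)
    have := (isFiniteLength_iff_isNoetherian_isArtinian.1 hfl).1
    infer_instance
  rw [Module.length_eq_finrank] at hlen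
  rw [← finrank_quotient_span hk hS hkS hf hfk, ← h]
  exact_mod_cast hlen.symm

/-! ### Units and the action of automorphisms -/

/-- The units of the coordinate ring are the nonzero constants. -/
theorem exists_mk_C_eq_of_isUnit [IsDedekindDomain (CoordRing S k L)] (hk : k ≠ 0) (hS : S ≠ 0)
    (hkS : Nat.Coprime k S.natDegree) {u : CoordRing S k L} (hu : IsUnit u) :
    ∃ c : L, AdjoinRoot.mk (equation S k L) (C (C c)) = u := by
  obtain ⟨v, hvk, rfl⟩ := exists_mk_eq hk u
  have hv : v ≠ 0 := fun h => by
    rw [h, map_zero] at hu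
    exact not_isUnit_zero hu
  have hd : (S.map (algebraMap K L)).natDegree = S.natDegree := natDegree_map _
  -- A unit has the zero divisor, hence weighted degree 0.
  have hw := card_eq_wdeg hk hS hkS hv hvk (s := 0)
    (by rw [vanishingIdeal_zero, Ideal.span_singleton_eq_top.2 hu])
  rw [Multiset.card_zero] at hw
  obtain ⟨j₀, -, heq, hlt⟩ := exists_wdeg_eq (S := S.map (algebraMap K L)) (by rwa [hd]) hv hvk
  rw [← hw, hd] at heq
  rw [← hw] at hlt
  have h1 : k * (v.coeff j₀).natDegree = 0 := by omega
  have h2 : S.natDegree * (j₀ : ℕ) = 0 := by omega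
  have hj₀ : (j₀ : ℕ) = 0 := by
    rcases Nat.mul_eq_zero.1 h2 with h | h
    -- If S is constant, coprimality forces k = 1, and then j₀ = 0.
    · rw [h, Nat.coprime_zero_right] at hkS
      have := j₀.2
      omega
    · exact h
  have hdeg := (Nat.mul_eq_zero.1 h1).resolve_left hk
  rw [hj₀] at hdeg
  refine ⟨(v.coeff 0).coeff 0, ?_⟩
  rw [← eq_C_of_natDegree_eq_zero hdeg]
  congr 1
  ext1 j
  rw [coeff_C]
  split_ifs with hj
  · rw [hj]
  · symm
    by_contra hc
    by_cases hjk : j < k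
    · exact Nat.not_lt_zero _ (hlt ⟨j, hjk⟩ (fun h => hj (by rw [← hj₀, ← h])) hc)
    · exact hc (coeff_eq_zero_of_degree_lt
        (hvk.trans_le (by exact_mod_cast not_lt.1 hjk)))

theorem equation_dvd_map (σ : L ≃ₐ[K] L) :
    equation S k L ∣ (equation S k L).map (mapRingHom (σ : L →+* L)) := by
  have h : (equation S k L).map (mapRingHom (σ : L →+* L)) = equation S k L := by
    rw [equation, Polynomial.map_sub, Polynomial.map_pow, map_X, map_C, coe_mapRingHom,
      Polynomial.map_map]
    congr 3
    exact RingHom.ext σ.commutes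
  rw [h]

/-- The action on regular functions of the automorphisms of `L` over `K`. -/
def conjRegular (S : K[X]) (k : ℕ) (σ : L ≃ₐ[K] L) : CoordRing S k L →+* CoordRing S k L :=
  AdjoinRoot.map (mapRingHom (σ : L →+* L)) (equation S k L) (equation S k L) (equation_dvd_map σ)

theorem conjRegular_mk (σ : L ≃ₐ[K] L) (f : L[X][X]) :
    conjRegular S k σ (AdjoinRoot.mk (equation S k L) f) =
      AdjoinRoot.mk (equation S k L) (f.map (mapRingHom (σ : L →+* L))) := by
  have h : (conjRegular S k σ).comp (AdjoinRoot.mk (equation S k L)) =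
      (AdjoinRoot.mk (equation S k L)).comp (mapRingHom (mapRingHom (σ : L →+* L))) := by
    refine Polynomial.ringHom_ext (fun a => ?_) ?_
    · refine (AdjoinRoot.map_of (mapRingHom (σ : L →+* L)) _ _
        (equation_dvd_map σ) a).trans ?_
      simp
    · refine (AdjoinRoot.map_root (mapRingHom (σ : L →+* L)) _ _
        (equation_dvd_map σ)).trans ?_
      simp
  exact congrArg (fun φ => φ f) h

theorem map_conjRegular_idealAt (σ : L ≃ₐ[K] L) (z : Point S k L) :
    (idealAt z).map (conjRegular S k σ) = idealAt (conj σ z) := by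
  have hx : conjRegular S k σ (xSub S k z.1.1) = xSub S k (conj σ z).1.1 := by
    refine (conjRegular_mk σ (C (X - C z.1.1))).trans ?_
    simp [conj, xSub]
  have hy : conjRegular S k σ (ySub S k z.1.2) = ySub S k (conj σ z).1.2 := by
    have h : ∀ b : L, ySub S k b = AdjoinRoot.mk (equation S k L) (X - C (C b)) := fun b => by
      rw [map_sub, AdjoinRoot.mk_X]; rfl
    rw [h, h, conjRegular_mk]
    simp [conj]
  rw [idealAt_eq_span, idealAt_eq_span, Ideal.map_span, Set.image_pair, hx, hy]

theorem map_conjRegular_vanishingIdeal (σ : L ≃ₐ[K] L) (s : Multiset (Point S k L)) :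
    (vanishingIdeal s).map (conjRegular S k σ) = vanishingIdeal (s.map (conj σ)) := by
  induction s using Multiset.induction_on with
  | empty => rw [Multiset.map_zero, vanishingIdeal_zero, Ideal.map_top]
  | cons z s ih =>
    rw [vanishingIdeal_cons, Ideal.map_mul, ih, Multiset.map_cons, vanishingIdeal_cons,
      map_conjRegular_idealAt]

theorem conj_injective (σ : L ≃ₐ[K] L) : Function.Injective (conj (S := S) (k := k) σ) := by
  intro z w h
  have h' := Prod.ext_iff.1 (Subtype.ext_iff.1 h)
  exact Subtype.ext (Prod.ext (σ.injective h'.1) (σ.injective h'.2))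

theorem conj_conj_symm (σ : L ≃ₐ[K] L) (z : Point S k L) : conj σ (conj σ.symm z) = z :=
  Subtype.ext (Prod.ext (σ.apply_symm_apply _) (σ.apply_symm_apply _))

open Classical in
theorem map_conj_eq {s : Multiset (Point S k L)} (σ : L ≃ₐ[K] L)
    (h : ∀ z, s.count (conj σ z) = s.count z) : s.map (conj σ) = s := by
  ext z
  rw [← conj_conj_symm σ z, Multiset.count_map_eq_count' _ _ (conj_injective σ), h]

theorem wdeg_map (f : K[X][X]) :
    wdeg (S.map (algebraMap K L)) k (f.map (mapRingHom (algebraMap K L))) = wdeg S k f := by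
  have hinj : Function.Injective (mapRingHom (algebraMap K L)) :=
    map_injective _ (algebraMap K L).injective
  rw [wdeg, wdeg, support_map_of_injective _ hinj, natDegree_map]
  refine Finset.sup_congr rfl fun j _ => ?_
  rw [coeff_map, coe_mapRingHom, support_map_of_injective _ (algebraMap K L).injective]

open Classical in
theorem Divisor.deg_eq_card {D : Divisor S k L} {s : Multiset (Point S k L)}
    (h : ∀ z, D z = s.count z) : D.deg = s.card := by
  have hsupp : D.support = s.toFinset := by
    ext z
    rw [Finsupp.mem_support_iff, h, Multiset.mem_toFinset, ← Multiset.count_ne_zero]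
    exact_mod_cast Iff.rfl
  rw [Divisor.deg, Finsupp.sum, hsupp, ← Multiset.toFinset_sum_count_eq]
  push_cast
  exact Finset.sum_congr rfl fun z _ => h z

/-! ### Effective principal divisors and regular functions -/

open Classical in
/-- A principal divisor that is effective is the divisor of a regular function. -/
theorem Divisor.IsPrincipal.exists_vanishingIdeal_eq [IsAlgClosed L]
    [IsDedekindDomain (CoordRing S k L)] (hk : k ≠ 0)
    (hdvr : ∀ z : Point S k L, IsDiscreteValuationRing (LocalRing z))
    {D : Divisor S k L} (hD : 0 ≤ D) (h : D.IsPrincipal) :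
    ∃ q : CoordRing S k L, q ≠ 0 ∧ ∃ s : Multiset (Point S k L),
      vanishingIdeal s = Ideal.span {q} ∧ ∀ z, D z = s.count z := by
  obtain ⟨φ, hφ, hφD⟩ := h
  set g := (IsLocalization.sec (nonZeroDivisors (CoordRing S k L)) φ).1 with hg
  set h := (IsLocalization.sec (nonZeroDivisors (CoordRing S k L)) φ).2 with hh
  have hspec : φ * algebraMap _ _ (h : CoordRing S k L) = algebraMap _ _ g :=
    IsLocalization.sec_spec (nonZeroDivisors (CoordRing S k L)) φ
  have hh0 : (h : CoordRing S k L) ≠ 0 := nonZeroDivisors.coe_ne_zero h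
  have hg0 : g ≠ 0 := fun h0 => by
    rw [h0, map_zero] at hspec
    refine mul_ne_zero hφ ?_ hspec
    rwa [ne_eq, FaithfulSMul.algebraMap_eq_zero_iff]
  obtain ⟨s, hs⟩ := Superelliptic.exists_vanishingIdeal_eq hk (Ideal.span {g}) (by simpa)
  obtain ⟨t, ht⟩ := Superelliptic.exists_vanishingIdeal_eq hk (Ideal.span {(h : CoordRing S k L)})
    (by simp)
  have hDst : ∀ z, D z = (s.count z : ℤ) - t.count z := fun z => by
    rw [hφD, ratOrdAt, ← hg, ← hh, ordAt_eq_count z hs, ordAt_eq_count z ht]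
    simp
  -- Effectivity of D says that the poles cancel: the divisor t of h is at most the divisor s of g,
  -- so h divides g.
  have hts : t ≤ s := Multiset.le_iff_count.2 fun z => by
    have h1 := hD z
    rw [hDst] at h1
    simpa using h1
  obtain ⟨q, hq⟩ : (h : CoordRing S k L) ∣ g := by
    rw [← Ideal.span_singleton_le_span_singleton, ← hs, ← ht]
    exact vanishingIdeal_anti hts
  have hq0 : q ≠ 0 := fun h0 => hg0 (by rw [hq, h0, mul_zero])
  obtain ⟨u, hu⟩ := Superelliptic.exists_vanishingIdeal_eq hk (Ideal.span {q}) (by simpa)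
  refine ⟨q, hq0, u, hu, fun z => ?_⟩
  have hord := ordAt_mul z (h : CoordRing S k L) q
  rw [← hq, ordAt_eq_count z hs, ordAt_eq_count z ht, ordAt_eq_count z hu] at hord
  have hord' : s.count z = t.count z + u.count z := by exact_mod_cast hord
  rw [hDst, hord']
  push_cast
  ring

open Classical in
/-- A regular function whose divisor is effective makes the divisor principal. -/
theorem Divisor.isPrincipal_of_ordAt_eq [IsAlgClosed L]
    [IsDedekindDomain (CoordRing S k L)] (hk : k ≠ 0)
    (hdvr : ∀ z : Point S k L, IsDiscreteValuationRing (LocalRing z))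
    {D : Divisor S k L} (hD : 0 ≤ D) (q : CoordRing S k L)
    (hq : ∀ z : Point S k L, ordAt z q = ((D z).toNat : ℕ∞)) : D.IsPrincipal := by
  -- The zero function has order ⊤ at every point, and the curve has a point over x = 0.
  have hq0 : q ≠ 0 := fun h0 => by
    obtain ⟨b, hb⟩ := IsAlgClosed.exists_pow_nat_eq (aeval (0 : L) S) (Nat.pos_of_ne_zero hk)
    let z : Point S k L := ⟨(0, b), hb⟩
    have := hq z
    rw [h0, ordAt_zero] at this
    exact ENat.natCast_ne_top _ this.symm
  refine ⟨algebraMap _ _ q, by rwa [ne_eq, FaithfulSMul.algebraMap_eq_zero_iff], fun z => ?_⟩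
  set φ := algebraMap (CoordRing S k L) (RationalFunction S k L) q
  set g := (IsLocalization.sec (nonZeroDivisors (CoordRing S k L)) φ).1 with hg
  set h := (IsLocalization.sec (nonZeroDivisors (CoordRing S k L)) φ).2 with hh
  have hspec : φ * algebraMap _ _ (h : CoordRing S k L) = algebraMap _ _ g :=
    IsLocalization.sec_spec (nonZeroDivisors (CoordRing S k L)) φ
  have hh0 : (h : CoordRing S k L) ≠ 0 := nonZeroDivisors.coe_ne_zero h
  rw [← map_mul] at hspec
  -- The fraction chosen by `sec` need not be q / 1, but its order is that of q by additivity.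
  have hgq : q * h = g := FaithfulSMul.algebraMap_injective _ _ hspec
  obtain ⟨t, ht⟩ := Superelliptic.exists_vanishingIdeal_eq hk (Ideal.span {(h : CoordRing S k L)})
    (by simp)
  rw [ratOrdAt, ← hg, ← hh, ← hgq, ordAt_mul, hq, ordAt_eq_count z ht, ← Nat.cast_add,
    ENat.toNat_natCast, ENat.toNat_natCast]
  have := Int.toNat_of_nonneg (hD z)
  push_cast
  omega

/-! ### Descent of the function to `K` -/

open Classical in
/-- If an effective divisor that is stable under the automorphisms of `L` over the perfect field
`K` is the divisor of a regular function, then it is the divisor of one with coefficients in `K`. -/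
theorem exists_toRegular_span_eq [PerfectField K] [IsAlgClosed L]
    [IsDedekindDomain (CoordRing S k L)] (hk : k ≠ 0) (hS : S ≠ 0)
    (hkS : Nat.Coprime k S.natDegree) {q : CoordRing S k L} (hq : q ≠ 0)
    {s : Multiset (Point S k L)} (hs : vanishingIdeal s = Ideal.span {q})
    (hconj : ∀ (σ : L ≃ₐ[K] L) (z : Point S k L), s.count (conj σ z) = s.count z) :
    ∃ f : K[X][X], f ≠ 0 ∧ f.degree < k ∧ vanishingIdeal s = Ideal.span {toRegular S k L f} := by
  obtain ⟨p, hpk, rfl⟩ := exists_mk_eq hk q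
  have hp : p ≠ 0 := fun h => hq (by rw [h, map_zero])
  -- Dividing by this coefficient removes the freedom of a constant factor.
  set a := p.leadingCoeff.leadingCoeff with ha
  have ha0 : a ≠ 0 := by simpa [ha] using hp
  set f₀ : L[X][X] := C (C a⁻¹) * p with hf₀
  have hCu : IsUnit (C (C a⁻¹) : L[X][X]) := isUnit_C.2 (isUnit_C.2 (inv_ne_zero ha0).isUnit)
  have hf₀0 : f₀ ≠ 0 := mul_ne_zero hCu.ne_zero hp
  have hf₀k : f₀.degree < k := by
    rwa [hf₀, degree_C_mul (fun h => hCu.ne_zero (by rw [h, C_0]))]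
  have hf₀s : vanishingIdeal s = Ideal.span {AdjoinRoot.mk (equation S k L) f₀} := by
    rw [hs, hf₀, map_mul, Ideal.span_singleton_mul_left_unit (hCu.map _)]
  have hlc : f₀.leadingCoeff.leadingCoeff = 1 := by
    rw [hf₀, leadingCoeff_mul, leadingCoeff_C, leadingCoeff_mul, leadingCoeff_C, ← ha,
      inv_mul_cancel₀ ha0]
  have hfix : ∀ σ : L ≃ₐ[K] L, f₀.map (mapRingHom (σ : L →+* L)) = f₀ := by
    intro σ
    have hσs := map_conjRegular_vanishingIdeal σ s
    rw [map_conj_eq σ (hconj σ), hf₀s, Ideal.map_span, Set.image_singleton, conjRegular_mk,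
      Ideal.span_singleton_eq_span_singleton] at hσs
    obtain ⟨u, hu⟩ := hσs.symm
    obtain ⟨c, hc⟩ := exists_mk_C_eq_of_isUnit hk hS hkS u.isUnit
    rw [← hc, ← map_mul] at hu
    have hdeg : (f₀ * C (C c)).degree < k :=
      by
      refine lt_of_le_of_lt ((degree_mul_le _ _).trans ?_) hf₀k
      exact (add_le_add_right degree_C_le _).trans (add_zero _).le
    have heq := mk_injOn (S := S) hk hdeg ((degree_map_le).trans_lt hf₀k) hu
    -- Now σ f₀ = c f₀; comparing the normalised coefficient 1 on both sides gives c = 1.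
    have hcoef := congrArg (fun v => (v.coeff f₀.natDegree).coeff f₀.leadingCoeff.natDegree) heq
    simp only [coeff_mul_C, coeff_map, coe_mapRingHom] at hcoef
    change f₀.leadingCoeff.leadingCoeff * c = σ f₀.leadingCoeff.leadingCoeff at hcoef
    rw [hlc, one_mul, map_one] at hcoef
    rw [← heq, hcoef, C_1, C_1, mul_one]
  have hlift : f₀ ∈ lifts (mapRingHom (algebraMap K L)) := by
    rw [lifts_iff_coeff_lifts]
    intro j
    have : f₀.coeff j ∈ lifts (algebraMap K L) := by
      rw [lifts_iff_coeff_lifts]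
      intro i
      refine IsAlgClosed.mem_range_algebraMap_of_fixed _ fun σ => ?_
      have := congrArg (fun v => (v.coeff j).coeff i) (hfix σ)
      simpa using this
    exact (mem_lifts _).1 this
  obtain ⟨f, hf⟩ := (mem_lifts _).1 hlift
  refine ⟨f, fun h => hf₀0 (by rw [← hf, h, Polynomial.map_zero]), ?_, by rw [hf₀s, ← hf]; rfl⟩
  have hinj : Function.Injective (mapRingHom (algebraMap K L)) :=
    map_injective _ (algebraMap K L).injective
  rwa [← degree_map_eq_of_injective hinj, hf]

end Superelliptic

end

/-! ### The main theorem -/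

theorem mainTheorem6 {K L : Type*} [Field K] [PerfectField K] [Field L] [IsAlgClosed L]
    [Algebra K L] (k : ℕ) (hk : (k : K) ≠ 0) (S : K[X]) (hS : S.Separable)
    (hkS : Nat.Coprime k S.natDegree) (D : Superelliptic.Divisor S k L) (hD : 0 ≤ D)
    (hDK : D.IsDefinedOverBase) :
    D.IsPrincipal ↔
      ∃ f : K[X][X], f.degree < k ∧
        (∀ z : Superelliptic.Point S k L,
          ((Superelliptic.ordAt z (Superelliptic.toRegular S k L f) : ℕ∞) = ((D z).toNat : ℕ∞))) ∧
        (Superelliptic.wdeg S k f : ℤ) = D.deg := by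
  classical
  have hk0 : k ≠ 0 := fun h => hk (by simp [h])
  have := Superelliptic.isDedekindDomain_coordRing (L := L) hk hS hkS
  have hdvr := Superelliptic.isDiscreteValuationRing_localRing (L := L) hk hS hkS
  refine ⟨fun h => ?_, fun ⟨f, _, hf, _⟩ =>
    Superelliptic.Divisor.isPrincipal_of_ordAt_eq hk0 hdvr hD _ hf⟩
  obtain ⟨q, hq, s, hs, hDs⟩ := h.exists_vanishingIdeal_eq hk0 hdvr hD
  obtain ⟨f, hf0, hfk, hsf⟩ := Superelliptic.exists_toRegular_span_eq hk0 hS.ne_zero hkS hq hs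
    fun σ z => by
      have := hDK σ z
      rw [hDs, hDs] at this
      exact_mod_cast this
  refine ⟨f, hfk, fun z => ?_, ?_⟩
  · rw [Superelliptic.ordAt_eq_count z hsf, hDs, Int.toNat_natCast]
  · have hinj : Function.Injective (mapRingHom (algebraMap K L)) :=
      map_injective _ (algebraMap K L).injective
    rw [Superelliptic.Divisor.deg_eq_card hDs,
      Superelliptic.card_eq_wdeg hk0 hS.ne_zero hkS
        ((Polynomial.map_ne_zero_iff hinj).2 hf0) (degree_map_le.trans_lt hfk) hsf,
      Superelliptic.wdeg_map]
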